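/- Let $h(X)=-\int p\ln p\in[-\infty,\infty]$ denote the differential entropy (in nats) of a real random variable $X$ with Lebesgue density $p$ (with $h(X)=-\infty$ if $X$ has no density). Let $N_2>0$ and $Z_2\sim\mathcal N(0,N_2)$. Then the supremum of $$h(X_1+Z_2+X_2)+h(X_1)-2h(X_1+Z_2)$$ over all distributions of $(X_1,X_2)$ for which this expression is well defined in $[-\infty,\infty]$, where $X_1,X_2,Z_2$ are independent real random variables and $\mathbb E[X_2^2]=N_2$, is strictly positive. Moreover, if $X_2$ is restricted to be Gaussian (still with $\mathbb E[X_2^2]=N_2$, and with $X_1$ arbitrary), then the supremum equals $0$. -/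

import Mathlib

open MeasureTheory ProbabilityTheory
open scoped NNReal ENNReal

/-- The differential entropy `h(μ) = -∫ p log p` (in nats) of a law `μ` on `ℝ` with Lebesgue
density `p`, as an extended real number: the integral of the positive part of `-p log p` minus the
integral of its negative part. A law without a density has entropy `-∞`. If both parts have
infinite integral, so that the entropy does not exist, the value is `⊤ - ⊤ = ⊥` in `EReal`. -/
noncomputable def diffEntropy (μ : Measure ℝ) : EReal :=
  open Classical in
  if μ ≪ volume then
    ((∫⁻ x, ENNReal.ofReal (Real.negMulLog (μ.rnDeriv volume x).toReal) : ℝ≥0∞) : EReal)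
      - ((∫⁻ x, ENNReal.ofReal (-Real.negMulLog (μ.rnDeriv volume x).toReal) : ℝ≥0∞) : EReal)
  else ⊥

/-- `h(X₁ + Z₂ + X₂) + h(X₁) - 2 h(X₁ + Z₂)` for independent `X₁ ∼ μ₁`, `X₂ ∼ μ₂` and
`Z₂ ∼ N(0, N₂)`; laws of sums of independent variables are convolutions. Every indeterminate
form (an entropy that does not exist, or `∞ - ∞`) gives `⊥` in `EReal`, and so never contributes
to a supremum; here the only subtracted entropy is that of a law with a bounded density, which
always exists and is not `⊥`. -/
noncomputable def entropyFunctional (N₂ : ℝ≥0) (μ₁ μ₂ : Measure ℝ) : EReal :=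
  diffEntropy ((μ₁.conv (gaussianReal 0 N₂)).conv μ₂) + diffEntropy μ₁
    - 2 * diffEntropy (μ₁.conv (gaussianReal 0 N₂))

/-- `μ` is the law of a real random variable `X` with `E[X²] = N`. -/
def IsLawWithPower (N : ℝ≥0) (μ : Measure ℝ) : Prop :=
  IsProbabilityMeasure μ ∧ MemLp id 2 μ ∧ ∫ x, x ^ 2 ∂μ = N

/-!
Let `p`, `q`, `r` be the densities of `X₁`, `X₁ + Z₂`, `X₁ + Z₂ + X₂`. Every entropy inequality
below is an instance of `log y ≤ y - 1`: if `f ≤ g + F - 1` pointwise with `E F ≤ c`, then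
`E f ≤ E g + c - 1` (`integrable_of_le_add_sub_one`, which also delivers the integrability of `f`,
and with it the finiteness of the entropy concerned). Here `F` is a quotient of densities whose
expectation is bounded by Tonelli's theorem and translation invariance of Lebesgue measure.

*Gaussian `X₂`.* For independent `X`, `Z`, `Z'` with `Z`, `Z'` identically distributed,
`h(X + Z + Z') + h(X) ≤ 2 h(X + Z)`: take
`F = q(X + Z) q(X + Z') / (p(X) r(X + Z + Z'))` (`entropy_conv_conv_add_le`). A Gaussian `X₂` with
`E X₂² = N₂` has variance at most `N₂`, so adding an independent Gaussian turns it into a copy of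
`Z₂`, which only increases entropy (`entropy_le_entropy_conv`). Hence the functional is at most `0`.
With `X₁ ∼ N(0, s)` it equals `log (s (s + 2 N₂) / (s + N₂)²) / 2`, which tends to `0` as `s → ∞`.

*Positivity.* Let `X₁` have density proportional to `exp (-(x / σ)⁴)` with `σ` large, and let
`X₂ = K` with probability `ε = N₂ / K²` and `X₂ = 0` otherwise, where `K = κ σ`. By Gibbs' inequality
with reference density `p`, `h(X₁ + Z₂) - h(X₁) ≤ 6 M N₂ / σ² + O(σ⁻³)`, where `M` is the second
moment of the undilated law, that is, `ε · 6 M κ²` to leading order. On the other hand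
`h(X₁ + Z₂ + X₂) - h(X₁ + Z₂)` is the mutual information between `X₂` and `X₁ + Z₂ + X₂`. Since the
density of `X₁` decays like the exponential of a fourth power, the event `X₁ + Z₂ + X₂ ≥ K / 2`
detects the jump with error probability about `exp (-κ⁴ / 512)`, so that this information is at
least `ε` times a multiple of `κ⁴` (`le_entropy_conv_rareJump_sub`, by the Donsker–Varadhan bound
`integral_le_entropy_conv_sub`). For `κ` large the second quantity exceeds the first.
-/

/-! ### Integrating `log y ≤ y - 1` -/

/-- Jensen's inequality for the logarithm in the form `log y ≤ y - 1`, with `F` in the role of `y`.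
Only the negative part of `f` has to be integrable beforehand. -/
theorem integrable_of_le_add_sub_one {Ω : Type*} [MeasurableSpace Ω] {P : Measure Ω}
    [IsProbabilityMeasure P] {f g : Ω → ℝ} {F : Ω → ℝ≥0∞} {c : ℝ} (hc : 0 ≤ c)
    (hf : AEStronglyMeasurable f P) (hneg : ∫⁻ ω, ENNReal.ofReal (-f ω) ∂P ≠ ⊤)
    (hg : Integrable g P) (hF : AEMeasurable F P) (hFc : ∫⁻ ω, F ω ∂P ≤ ENNReal.ofReal c)
    (h : ∀ᵐ ω ∂P, f ω ≤ g ω + (F ω).toReal - 1) :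
    Integrable f P ∧ ∫ ω, f ω ∂P ≤ ∫ ω, g ω ∂P + c - 1 := by
  have hFt : ∫⁻ ω, F ω ∂P ≠ ⊤ := (hFc.trans_lt ENNReal.ofReal_lt_top).ne
  have hFi : Integrable (fun ω => (F ω).toReal) P := integrable_toReal_of_lintegral_ne_top hF hFt
  have hFint : ∫ ω, (F ω).toReal ∂P ≤ c := by
    rw [integral_toReal hF (ae_lt_top' hF hFt)]
    exact ENNReal.toReal_le_of_le_ofReal hc hFc
  have hG : Integrable (fun ω => g ω + (F ω).toReal - 1) P :=
    (hg.add hFi).sub (integrable_const 1)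
  have hfi : Integrable f P := by
    refine ⟨hf, ?_⟩
    have hb : ∀ᵐ ω ∂P, ‖f ω‖ₑ ≤
        ENNReal.ofReal (-f ω) + ‖g ω + (F ω).toReal - 1‖ₑ := by
      filter_upwards [h] with ω hω
      rcases le_total 0 (f ω) with h0 | h0
      · refine le_add_left ?_
        rw [← ofReal_norm, ← ofReal_norm]
        apply ENNReal.ofReal_le_ofReal
        rw [Real.norm_of_nonneg h0]
        exact hω.trans (le_abs_self _)
      · refine le_add_right ?_
        rw [← ofReal_norm, Real.norm_of_nonpos h0]
    refine (lintegral_mono_ae hb).trans_lt ?_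
    rw [lintegral_add_right' _ hG.1.enorm]
    exact ENNReal.add_lt_top.2 ⟨hneg.lt_top, hG.2⟩
  refine ⟨hfi, (integral_mono_ae hfi hG h).trans ?_⟩
  rw [integral_sub (f := fun ω => g ω + (F ω).toReal) (hg.add hFi) (integrable_const 1),
    integral_add hg hFi]
  simp only [integral_const, probReal_univ, smul_eq_mul, mul_one]
  linarith

/-! ### Laws with a density and their differential entropy -/

/-- `f` is a Lebesgue density of `μ`: a measurable, everywhere defined representative with values
in `[0, ∞]`, so that convolutions of densities are defined pointwise. -/
structure HasDensity (μ : Measure ℝ) (f : ℝ → ℝ≥0∞) : Prop where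
  measurable : Measurable f
  eq_withDensity : μ = volume.withDensity f

namespace HasDensity

variable {μ : Measure ℝ} {f : ℝ → ℝ≥0∞}

theorem absolutelyContinuous (h : HasDensity μ f) : μ ≪ volume := by
  rw [h.eq_withDensity]; exact withDensity_absolutelyContinuous _ _

theorem rnDeriv_ae_eq (h : HasDensity μ f) : μ.rnDeriv volume =ᵐ[volume] f := by
  rw [h.eq_withDensity]; exact Measure.rnDeriv_withDensity _ h.measurable

theorem of_absolutelyContinuous [IsFiniteMeasure μ] (h : μ ≪ volume) :
    HasDensity μ (μ.rnDeriv volume) :=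
  ⟨Measure.measurable_rnDeriv _ _, (Measure.withDensity_rnDeriv_eq _ _ h).symm⟩

theorem lintegral_eq (h : HasDensity μ f) {g : ℝ → ℝ≥0∞} (hg : Measurable g) :
    ∫⁻ x, g x ∂μ = ∫⁻ x, f x * g x := by
  conv_lhs => rw [h.eq_withDensity]
  rw [lintegral_withDensity_eq_lintegral_mul _ h.measurable hg]
  rfl

theorem lintegral_density [IsProbabilityMeasure μ] (h : HasDensity μ f) : ∫⁻ x, f x = 1 := by
  have := h.lintegral_eq (g := fun _ => 1) measurable_const
  simpa using this.symm

theorem ae_ne_zero (h : HasDensity μ f) : ∀ᵐ x ∂μ, f x ≠ 0 := by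
  rw [h.eq_withDensity, ae_withDensity_iff h.measurable]
  exact Filter.Eventually.of_forall fun _ hx => hx

theorem ae_ne_top [IsProbabilityMeasure μ] (h : HasDensity μ f) : ∀ᵐ x ∂μ, f x ≠ ⊤ := by
  have : ∀ᵐ x, f x < ⊤ := ae_lt_top h.measurable (by simp [h.lintegral_density])
  filter_upwards [h.absolutelyContinuous.ae_le this] with x hx using hx.ne

theorem ae_toReal_pos [IsProbabilityMeasure μ] (h : HasDensity μ f) :
    ∀ᵐ x ∂μ, f x ≠ 0 ∧ f x ≠ ⊤ ∧ 0 < (f x).toReal := by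
  filter_upwards [h.ae_ne_zero, h.ae_ne_top] with x h1 h2
  exact ⟨h1, h2, ENNReal.toReal_pos h1 h2⟩

theorem measurable_log (h : HasDensity μ f) : Measurable fun x => Real.log (f x).toReal :=
  Real.measurable_log.comp h.measurable.ennreal_toReal

/-- The positive and negative parts of the entropy as expectations under the law itself. -/
theorem diffEntropy_eq [IsProbabilityMeasure μ] (h : HasDensity μ f) :
    diffEntropy μ = ((∫⁻ x, ENNReal.ofReal (-Real.log (f x).toReal) ∂μ : ℝ≥0∞) : EReal)
      - ((∫⁻ x, ENNReal.ofReal (Real.log (f x).toReal) ∂μ : ℝ≥0∞) : EReal) := by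
  have hfin : ∀ᵐ x, f x < ⊤ := ae_lt_top h.measurable (by simp [h.lintegral_density])
  rw [diffEntropy, if_pos h.absolutelyContinuous,
    h.lintegral_eq (g := fun x => ENNReal.ofReal (-Real.log (f x).toReal))
      h.measurable_log.neg.ennreal_ofReal,
    h.lintegral_eq (h.measurable_log.ennreal_ofReal)]
  congr 2
  · refine lintegral_congr_ae ?_
    filter_upwards [h.rnDeriv_ae_eq, hfin] with x hx hx'
    rw [hx, Real.negMulLog, neg_mul, ← mul_neg, ENNReal.ofReal_mul ENNReal.toReal_nonneg,
      ENNReal.ofReal_toReal hx'.ne]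
  · refine lintegral_congr_ae ?_
    filter_upwards [h.rnDeriv_ae_eq, hfin] with x hx hx'
    rw [hx, Real.negMulLog, neg_mul, neg_neg, ENNReal.ofReal_mul ENNReal.toReal_nonneg,
      ENNReal.ofReal_toReal hx'.ne]

theorem diffEntropy_eq_integral [IsProbabilityMeasure μ] (h : HasDensity μ f)
    (hi : Integrable (fun x => Real.log (f x).toReal) μ) :
    diffEntropy μ = ((-∫ x, Real.log (f x).toReal ∂μ : ℝ) : EReal) := by
  have h1 : ∫⁻ x, ENNReal.ofReal (Real.log (f x).toReal) ∂μ ≠ ⊤ := hi.lintegral_lt_top.ne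
  have h2 : ∫⁻ x, ENNReal.ofReal (-Real.log (f x).toReal) ∂μ ≠ ⊤ := hi.neg.lintegral_lt_top.ne
  rw [h.diffEntropy_eq, integral_eq_lintegral_pos_part_sub_lintegral_neg_part hi, neg_sub,
    EReal.coe_sub, EReal.coe_ennreal_toReal h1, EReal.coe_ennreal_toReal h2]

theorem lintegral_log_ne_top_of_ne_bot [IsProbabilityMeasure μ] (h : HasDensity μ f)
    (hb : diffEntropy μ ≠ ⊥) : ∫⁻ x, ENNReal.ofReal (Real.log (f x).toReal) ∂μ ≠ ⊤ := by
  intro ht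
  apply hb
  rw [h.diffEntropy_eq, ht]
  simp [sub_eq_add_neg]

theorem lintegral_log_ne_top_of_le [IsProbabilityMeasure μ] (h : HasDensity μ f) {B : ℝ≥0}
    (hB : ∀ x, f x ≤ B) : ∫⁻ x, ENNReal.ofReal (Real.log (f x).toReal) ∂μ ≠ ⊤ := by
  have : ∀ᵐ x ∂μ, ENNReal.ofReal (Real.log (f x).toReal) ≤ ENNReal.ofReal (Real.log B) := by
    filter_upwards [h.ae_toReal_pos] with x hx
    refine ENNReal.ofReal_le_ofReal (Real.log_le_log hx.2.2 ?_)
    exact ENNReal.toReal_le_coe_of_le_coe (hB x)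
  refine ((lintegral_mono_ae this).trans_lt ?_).ne
  simp

/-- If the negative part of the entropy is finite, the entropy is either `⊤` or an absolutely
convergent integral. -/
theorem integrable_log_of_ne_top [IsProbabilityMeasure μ] (h : HasDensity μ f)
    (hl : ∫⁻ x, ENNReal.ofReal (Real.log (f x).toReal) ∂μ ≠ ⊤) (ht : diffEntropy μ ≠ ⊤) :
    Integrable (fun x => Real.log (f x).toReal) μ := by
  have h2 : ∫⁻ x, ENNReal.ofReal (-Real.log (f x).toReal) ∂μ ≠ ⊤ := by
    intro hT
    apply ht
    rw [h.diffEntropy_eq, hT]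
    lift (∫⁻ x, ENNReal.ofReal (Real.log (f x).toReal) ∂μ) to ℝ≥0 using hl with b
    exact EReal.top_sub_coe (b : ℝ)
  have := integrable_of_le_add_sub_one (P := μ) (f := fun x => Real.log (f x).toReal)
    (g := fun _ => 1) (F := fun x => ENNReal.ofReal (Real.log (f x).toReal))
    (c := (∫⁻ x, ENNReal.ofReal (Real.log (f x).toReal) ∂μ).toReal) ENNReal.toReal_nonneg
    h.measurable_log.aestronglyMeasurable h2 (integrable_const 1)
    h.measurable_log.ennreal_ofReal.aemeasurable (by rw [ENNReal.ofReal_toReal hl])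
    (Filter.Eventually.of_forall fun x => by
      simp only [add_sub_cancel_left]
      rw [ENNReal.toReal_ofReal']
      exact le_max_left _ _)
  exact this.1

theorem lintegral_div_le (h : HasDensity μ f) {F : ℝ → ℝ≥0∞} (hF : Measurable F) :
    ∫⁻ x, F x / f x ∂μ ≤ ∫⁻ x, F x := by
  rw [h.lintegral_eq (g := fun x => F x / f x) (hF.div h.measurable)]
  exact lintegral_mono fun x => ENNReal.mul_div_le

/-- Convolving with any law preserves having a density; the new density is the average of
translates of the old one. -/
theorem conv (h : HasDensity μ f) (ν : Measure ℝ) [IsProbabilityMeasure ν]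
    [IsProbabilityMeasure μ] :
    HasDensity (μ.conv ν) (fun t => ∫⁻ z, f (t - z) ∂ν) := by
  have hm : Measurable (fun t => ∫⁻ z, f (t - z) ∂ν) :=
    Measurable.lintegral_prod_right' (f := fun y : ℝ × ℝ => f (y.1 - y.2))
      (h.measurable.comp (measurable_fst.sub measurable_snd))
  refine ⟨hm, ?_⟩
  have hf := h.measurable
  refine Measure.ext_of_lintegral _ fun g hg => ?_
  rw [Measure.lintegral_conv hg, lintegral_withDensity_eq_lintegral_mul _ hm hg]
  rw [lintegral_lintegral_swap (by fun_prop)]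
  have hmul : ∀ t, (∫⁻ z, f (t - z) ∂ν) * g t = ∫⁻ z, f (t - z) * g t ∂ν := fun t =>
    (lintegral_mul_const _ (by fun_prop)).symm
  simp_rw [Pi.mul_apply, hmul]
  conv_rhs => rw [lintegral_lintegral_swap (by fun_prop)]
  refine lintegral_congr fun z => ?_
  rw [h.lintegral_eq (by fun_prop)]
  rw [← lintegral_sub_right_eq_self _ z]
  simp

end HasDensity

/-! ### Laws of sums of independent variables -/

section Sums

theorem measurePreserving_add_prod {μ ν : Measure ℝ} :
    MeasurePreserving (fun y : ℝ × ℝ => y.1 + y.2) (μ.prod ν) (μ.conv ν) :=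
  ⟨by fun_prop, rfl⟩

theorem measurePreserving_fst_prod_prod {μ ν : Measure ℝ} [IsProbabilityMeasure ν] :
    MeasurePreserving (fun y : ℝ × ℝ × ℝ => y.1) (μ.prod (ν.prod ν)) μ :=
  measurePreserving_fst

variable {μ ν : Measure ℝ} [IsProbabilityMeasure μ] [IsProbabilityMeasure ν]

theorem measurePreserving_add_fst_prod_prod :
    MeasurePreserving (fun y : ℝ × ℝ × ℝ => y.1 + y.2.1) (μ.prod (ν.prod ν)) (μ.conv ν) :=
  measurePreserving_add_prod.comp ((MeasurePreserving.id μ).prod measurePreserving_fst)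

theorem measurePreserving_add_snd_prod_prod :
    MeasurePreserving (fun y : ℝ × ℝ × ℝ => y.1 + y.2.2) (μ.prod (ν.prod ν)) (μ.conv ν) :=
  measurePreserving_add_prod.comp ((MeasurePreserving.id μ).prod measurePreserving_snd)

theorem measurePreserving_add_add_prod_prod :
    MeasurePreserving (fun y : ℝ × ℝ × ℝ => y.1 + y.2.1 + y.2.2) (μ.prod (ν.prod ν))
      ((μ.conv ν).conv ν) := by
  have h : MeasurePreserving (fun y : (ℝ × ℝ) × ℝ => (y.1.1 + y.1.2, y.2))
      ((μ.prod ν).prod ν) ((μ.conv ν).prod ν) :=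
    measurePreserving_add_prod.prod (MeasurePreserving.id ν)
  exact measurePreserving_add_prod.comp
    (h.comp (measurePreserving_prodAssoc μ ν ν).symm)

end Sums

theorem MeasureTheory.MeasurePreserving.integral_comp_of_measurable {α β : Type*}
    [MeasurableSpace α] [MeasurableSpace β] {μ : Measure α} {ν : Measure β} {T : α → β}
    (hT : MeasurePreserving T μ ν) {g : β → ℝ} (hg : Measurable g) :
    ∫ x, g (T x) ∂μ = ∫ y, g y ∂ν := by
  rw [← hT.map_eq, integral_map hT.measurable.aemeasurable hg.aestronglyMeasurable]

/-! ### Entropy inequalities for sums -/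

section Inequalities

variable {μ ν : Measure ℝ} [IsProbabilityMeasure μ] [IsProbabilityMeasure ν]
  {p q : ℝ → ℝ≥0∞}

theorem ENNReal.log_sub_log_le_toReal_div {a b : ℝ≥0∞} (ha : 0 < a.toReal) (hb : 0 < b.toReal) :
    Real.log a.toReal - Real.log b.toReal ≤ (a / b).toReal - 1 := by
  rw [← Real.log_div ha.ne' hb.ne', ENNReal.toReal_div]
  exact Real.log_le_sub_one_of_pos (by positivity)

/-- Adding independent noise does not decrease differential entropy; here `F = q(X + Z) / p(X)`. -/
theorem entropy_le_entropy_conv (hp : HasDensity μ p) (hq : HasDensity (μ.conv ν) q)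
    (hlp : ∫⁻ x, ENNReal.ofReal (Real.log (p x).toReal) ∂μ ≠ ⊤)
    (hlq : Integrable (fun x => Real.log (q x).toReal) (μ.conv ν)) :
    Integrable (fun x => Real.log (p x).toReal) μ ∧
      -∫ x, Real.log (p x).toReal ∂μ ≤ -∫ x, Real.log (q x).toReal ∂(μ.conv ν) := by
  have mq := hq.measurable
  have mp := hp.measurable
  have mlp := hp.measurable_log
  have h1 : MeasurePreserving (fun y : ℝ × ℝ => y.1) (μ.prod ν) μ := measurePreserving_fst
  have h2 := measurePreserving_add_prod (μ := μ) (ν := ν)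
  have key := integrable_of_le_add_sub_one (P := μ.prod ν)
    (f := fun y => -Real.log (p y.1).toReal) (g := fun y => -Real.log (q (y.1 + y.2)).toReal)
    (F := fun y => q (y.1 + y.2) / p y.1) (c := 1) zero_le_one
    (mlp.comp measurable_fst).neg.aestronglyMeasurable
    (by
      simp only [neg_neg]
      rwa [h1.lintegral_comp (f := fun x => ENNReal.ofReal (Real.log (p x).toReal))
        mlp.ennreal_ofReal])
    (h2.integrable_comp_of_integrable hlq).neg
    (by fun_prop)
    (by
      rw [lintegral_prod_symm' _ (by fun_prop), ENNReal.ofReal_one]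
      have : ∀ z, ∫⁻ x, q (x + z) / p x ∂μ ≤ 1 := fun z => by
        refine (hp.lintegral_div_le (F := fun x => q (x + z)) (by fun_prop)).trans ?_
        rw [lintegral_add_right_eq_self q z, hq.lintegral_density]
      refine (lintegral_mono this).trans (by simp))
    (by
      filter_upwards [h1.quasiMeasurePreserving.ae hp.ae_toReal_pos,
        h2.quasiMeasurePreserving.ae hq.ae_toReal_pos] with y hy1 hy2
      have := ENNReal.log_sub_log_le_toReal_div hy2.2.2 hy1.2.2
      linarith)
  obtain ⟨ki, kl⟩ := key
  have ki' : Integrable (fun x => Real.log (p x).toReal) μ := by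
    rw [← h1.integrable_comp mlp.aestronglyMeasurable]
    exact (integrable_neg_iff.1 ki)
  refine ⟨ki', ?_⟩
  rw [integral_neg, integral_neg, h1.integral_comp_of_measurable mlp,
    h2.integral_comp_of_measurable hq.measurable_log] at kl
  linarith

/-- Adding a second independent copy of the same noise increases the entropy by at most as much as
adding the first one: `h(X + Z + Z') + h(X) ≤ 2 h(X + Z)`. -/
theorem entropy_conv_conv_add_le (hp : HasDensity μ p) (hq : HasDensity (μ.conv ν) q)
    (hr : HasDensity ((μ.conv ν).conv ν) (fun t => ∫⁻ z, q (t - z) ∂ν))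
    (hlp : Integrable (fun x => Real.log (p x).toReal) μ)
    (hlq : Integrable (fun x => Real.log (q x).toReal) (μ.conv ν))
    (hlr : ∫⁻ x, ENNReal.ofReal (Real.log (∫⁻ z, q (x - z) ∂ν).toReal) ∂((μ.conv ν).conv ν) ≠ ⊤) :
    Integrable (fun x => Real.log (∫⁻ z, q (x - z) ∂ν).toReal) ((μ.conv ν).conv ν) ∧
      -∫ x, Real.log (∫⁻ z, q (x - z) ∂ν).toReal ∂((μ.conv ν).conv ν)
        + -∫ x, Real.log (p x).toReal ∂μ
        ≤ 2 * -∫ x, Real.log (q x).toReal ∂(μ.conv ν) := by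
  set r : ℝ → ℝ≥0∞ := fun t => ∫⁻ z, q (t - z) ∂ν with hrdef
  have mq := hq.measurable
  have mp := hp.measurable
  have mr : Measurable r := hr.measurable
  have mlp := hp.measurable_log
  have mlq := hq.measurable_log
  have mlr := hr.measurable_log
  have h1 := measurePreserving_fst_prod_prod (μ := μ) (ν := ν)
  have h2 := measurePreserving_add_fst_prod_prod (μ := μ) (ν := ν)
  have h3 := measurePreserving_add_snd_prod_prod (μ := μ) (ν := ν)
  have h4 := measurePreserving_add_add_prod_prod (μ := μ) (ν := ν)
  have i1 : Integrable (fun y : ℝ × ℝ × ℝ => Real.log (p y.1).toReal) (μ.prod (ν.prod ν)) :=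
    h1.integrable_comp_of_integrable hlp
  have i2 : Integrable (fun y : ℝ × ℝ × ℝ => Real.log (q (y.1 + y.2.1)).toReal)
    (μ.prod (ν.prod ν)) := h2.integrable_comp_of_integrable hlq
  have i3 : Integrable (fun y : ℝ × ℝ × ℝ => Real.log (q (y.1 + y.2.2)).toReal)
    (μ.prod (ν.prod ν)) := h3.integrable_comp_of_integrable hlq
  have key := integrable_of_le_add_sub_one (P := μ.prod (ν.prod ν))
    (f := fun y => -Real.log (r (y.1 + y.2.1 + y.2.2)).toReal)
    (g := fun y => Real.log (p y.1).toReal - Real.log (q (y.1 + y.2.1)).toReal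
      - Real.log (q (y.1 + y.2.2)).toReal)
    (F := fun y => q (y.1 + y.2.1) * q (y.1 + y.2.2) / r (y.1 + y.2.1 + y.2.2) / p y.1)
    (c := 1) zero_le_one
    (mlr.comp h4.measurable).neg.aestronglyMeasurable
    (by
      simp only [neg_neg]
      rwa [h4.lintegral_comp (f := fun x => ENNReal.ofReal (Real.log (r x).toReal))
        mlr.ennreal_ofReal])
    ((i1.sub i2).sub i3)
    (by fun_prop)
    (by
      rw [lintegral_prod_symm' _ (by fun_prop), ENNReal.ofReal_one]
      -- the density of `X` cancels, and the substitution `t = x + z + w` separates `z` and `w`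
      have hx : ∀ y : ℝ × ℝ,
          ∫⁻ x, q (x + y.1) * q (x + y.2) / r (x + y.1 + y.2) / p x ∂μ
            ≤ ∫⁻ t, q (t - y.2) * q (t - y.1) / r t := fun y => by
        refine (hp.lintegral_div_le
          (F := fun x => q (x + y.1) * q (x + y.2) / r (x + y.1 + y.2)) (by fun_prop)).trans ?_
        rw [← lintegral_add_right_eq_self (fun t => q (t - y.2) * q (t - y.1) / r t) (y.1 + y.2)]
        refine le_of_eq (lintegral_congr fun x => ?_)
        rw [show x + (y.1 + y.2) - y.2 = x + y.1 by ring,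
          show x + (y.1 + y.2) - y.1 = x + y.2 by ring, ← add_assoc]
      refine (lintegral_mono hx).trans ?_
      rw [lintegral_lintegral_swap (by fun_prop)]
      have ht : ∀ t, ∫⁻ y : ℝ × ℝ, q (t - y.2) * q (t - y.1) / r t ∂(ν.prod ν) ≤ r t := fun t => by
        have e : ∀ y : ℝ × ℝ, q (t - y.2) * q (t - y.1) / r t
            = q (t - y.1) * q (t - y.2) * (r t)⁻¹ := fun y => by
          rw [div_eq_mul_inv, mul_comm (q (t - y.2))]
        simp_rw [e]
        rw [lintegral_mul_const _ (by fun_prop),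
          lintegral_prod_mul (f := fun z => q (t - z)) (g := fun z => q (t - z))
            (by fun_prop) (by fun_prop), ← div_eq_mul_inv, mul_div_assoc]
        exact ENNReal.mul_div_le
      refine (lintegral_mono ht).trans ?_
      rw [hr.lintegral_density])
    (by
      filter_upwards [h1.quasiMeasurePreserving.ae hp.ae_toReal_pos,
        h2.quasiMeasurePreserving.ae hq.ae_toReal_pos,
        h3.quasiMeasurePreserving.ae hq.ae_toReal_pos,
        h4.quasiMeasurePreserving.ae hr.ae_toReal_pos] with y ⟨_, _, y1⟩ ⟨_, _, y2⟩ ⟨_, _, y3⟩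
          ⟨_, _, y4⟩
      rw [ENNReal.toReal_div, ENNReal.toReal_div, ENNReal.toReal_mul]
      have := Real.log_le_sub_one_of_pos (div_pos (div_pos (mul_pos y2 y3) y4) y1)
      rw [Real.log_div (by positivity) y1.ne', Real.log_div (by positivity) y4.ne',
        Real.log_mul y2.ne' y3.ne'] at this
      linarith)
  obtain ⟨ki, kl⟩ := key
  refine ⟨?_, ?_⟩
  · rw [← h4.integrable_comp mlr.aestronglyMeasurable]
    exact (integrable_neg_iff.1 ki)
  rw [integral_neg, integral_sub (f := fun y : ℝ × ℝ × ℝ =>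
      Real.log (p y.1).toReal - Real.log (q (y.1 + y.2.1)).toReal) (i1.sub i2) i3,
    integral_sub i1 i2,
    h1.integral_comp_of_measurable mlp, h2.integral_comp_of_measurable mlq,
    h3.integral_comp_of_measurable mlq, h4.integral_comp_of_measurable mlr] at kl
  linarith

/-- Gibbs' inequality: the cross entropy with respect to any probability density is at least the
entropy. -/
theorem entropy_le_cross_entropy (hp : HasDensity μ p) (hq : HasDensity ν q)
    (hlq : ∫⁻ x, ENNReal.ofReal (Real.log (q x).toReal) ∂ν ≠ ⊤) (hp0 : ∀ x, 0 < (p x).toReal)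
    (hlp : Integrable (fun x => Real.log (p x).toReal) ν) :
    Integrable (fun x => Real.log (q x).toReal) ν ∧
      -∫ x, Real.log (q x).toReal ∂ν ≤ -∫ x, Real.log (p x).toReal ∂ν := by
  have mq := hq.measurable
  have mp := hp.measurable
  have key := integrable_of_le_add_sub_one (P := ν)
    (f := fun x => -Real.log (q x).toReal) (g := fun x => -Real.log (p x).toReal)
    (F := fun x => p x / q x) (c := 1) zero_le_one
    hq.measurable_log.neg.aestronglyMeasurable (by simpa only [neg_neg] using hlq)
    hlp.neg (by fun_prop)
    (by rw [ENNReal.ofReal_one, ← hp.lintegral_density]; exact hq.lintegral_div_le mp)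
    (by
      filter_upwards [hq.ae_toReal_pos] with x hx
      have := ENNReal.log_sub_log_le_toReal_div (hp0 x) hx.2.2
      linarith)
  refine ⟨integrable_neg_iff.1 key.1, ?_⟩
  have := key.2
  rw [integral_neg, integral_neg] at this
  linarith

/-- A Donsker–Varadhan lower bound for the entropy increment `h(X + W) - h(X)`, which is the
mutual information between `W` and `X + W`: the test function `φ (w, t)` is integrated against the
joint law of `(W, X + W)`, and its exponential against the product of the marginals. -/
theorem integral_le_entropy_conv_sub (hp : HasDensity μ p) (hq : HasDensity (μ.conv ν) q)
    (hlp : Integrable (fun x => Real.log (p x).toReal) μ)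
    (hlq : Integrable (fun x => Real.log (q x).toReal) (μ.conv ν))
    {φ : ℝ → ℝ → ℝ} (hφ : Measurable (Function.uncurry φ))
    (hφi : Integrable (fun y : ℝ × ℝ => φ y.2 (y.1 + y.2)) (μ.prod ν)) {c : ℝ} (hc : 0 ≤ c)
    (hφc : ∫⁻ w, ∫⁻ t, ENNReal.ofReal (Real.exp (φ w t)) ∂(μ.conv ν) ∂ν ≤ ENNReal.ofReal c) :
    ∫ y, φ y.2 (y.1 + y.2) ∂(μ.prod ν) ≤
      -∫ x, Real.log (q x).toReal ∂(μ.conv ν) - -∫ x, Real.log (p x).toReal ∂μ + c - 1 := by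
  have mq := hq.measurable
  have mp := hp.measurable
  have mφ : Measurable fun y : ℝ × ℝ => φ y.1 y.2 := hφ
  have h1 : MeasurePreserving (fun y : ℝ × ℝ => y.1) (μ.prod ν) μ := measurePreserving_fst
  have h2 := measurePreserving_add_prod (μ := μ) (ν := ν)
  have i1 : Integrable (fun y : ℝ × ℝ => Real.log (p y.1).toReal) (μ.prod ν) :=
    h1.integrable_comp_of_integrable hlp
  have i2 : Integrable (fun y : ℝ × ℝ => Real.log (q (y.1 + y.2)).toReal) (μ.prod ν) :=
    h2.integrable_comp_of_integrable hlq
  have mE : Measurable fun y : ℝ × ℝ => ENNReal.ofReal (Real.exp (φ y.1 y.2)) :=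
    (Real.measurable_exp.comp mφ).ennreal_ofReal
  have mE' : Measurable fun y : ℝ × ℝ => ENNReal.ofReal (Real.exp (φ y.2 (y.1 + y.2))) :=
    mE.comp (measurable_snd.prodMk (measurable_fst.add measurable_snd))
  have key := integrable_of_le_add_sub_one (P := μ.prod ν)
    (f := fun y => φ y.2 (y.1 + y.2))
    (g := fun y => Real.log (p y.1).toReal - Real.log (q (y.1 + y.2)).toReal)
    (F := fun y => ENNReal.ofReal (Real.exp (φ y.2 (y.1 + y.2))) * q (y.1 + y.2) / p y.1)
    (c := c) hc hφi.1 hφi.neg.lintegral_lt_top.ne (i1.sub i2) (by fun_prop)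
    (by
      rw [lintegral_prod_symm' _ (by fun_prop)]
      refine le_trans (lintegral_mono fun w => ?_) hφc
      have mw : Measurable fun t => ENNReal.ofReal (Real.exp (φ w t)) :=
        mE.comp (measurable_const.prodMk measurable_id)
      refine (hp.lintegral_div_le (F := fun x => ENNReal.ofReal (Real.exp (φ w (x + w))) * q (x + w))
        ((mw.comp (by fun_prop)).mul (by fun_prop))).trans ?_
      rw [lintegral_add_right_eq_self (fun t => ENNReal.ofReal (Real.exp (φ w t)) * q t) w,
        hq.lintegral_eq mw]
      simp_rw [mul_comm]
      exact le_rfl)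
    (by
      filter_upwards [h1.quasiMeasurePreserving.ae hp.ae_toReal_pos,
        h2.quasiMeasurePreserving.ae hq.ae_toReal_pos] with y ⟨_, _, y1⟩ ⟨_, _, y2⟩
      rw [ENNReal.toReal_div, ENNReal.toReal_mul, ENNReal.toReal_ofReal (Real.exp_pos _).le]
      have := Real.log_le_sub_one_of_pos
        (div_pos (mul_pos (Real.exp_pos (φ y.2 (y.1 + y.2))) y2) y1)
      rw [Real.log_div (by positivity) y1.ne', Real.log_mul (by positivity) y2.ne',
        Real.log_exp] at this
      linarith)
  have := key.2
  rw [integral_sub i1 i2, h1.integral_comp_of_measurable hp.measurable_log,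
    h2.integral_comp_of_measurable hq.measurable_log] at this
  linarith

end Inequalities

/-! ### Gaussian smoothing and Gaussian `X₂` -/

theorem hasDensity_gaussianReal (m : ℝ) {v : ℝ≥0} (hv : v ≠ 0) :
    HasDensity (gaussianReal m v) (gaussianPDF m v) :=
  ⟨measurable_gaussianPDF m v, gaussianReal_of_var_ne_zero m hv⟩

theorem gaussianPDF_le (m : ℝ) (v : ℝ≥0) (x : ℝ) :
    gaussianPDF m v x ≤ ((√(2 * Real.pi * v))⁻¹).toNNReal := by
  rw [gaussianPDF, ← ENNReal.ofReal]
  refine ENNReal.ofReal_le_ofReal ?_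
  rw [gaussianPDFReal]
  refine mul_le_of_le_one_right (by positivity) (Real.exp_le_one_iff.2 ?_)
  rw [neg_div]
  exact neg_nonpos.2 (by positivity)

theorem lintegral_comp_sub_le {f : ℝ → ℝ≥0∞} {B : ℝ≥0∞} (hB : ∀ x, f x ≤ B) (ν : Measure ℝ)
    [IsProbabilityMeasure ν] (t : ℝ) : ∫⁻ z, f (t - z) ∂ν ≤ B :=
  (lintegral_mono fun z => hB (t - z)).trans (by simp)

/-- A law smoothed by a Gaussian has a bounded density. -/
theorem exists_hasDensity_conv_gaussianReal (μ : Measure ℝ) [IsProbabilityMeasure μ] {N : ℝ≥0}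
    (hN : N ≠ 0) : ∃ (q : ℝ → ℝ≥0∞) (B : ℝ≥0), HasDensity (μ.conv (gaussianReal 0 N)) q ∧
      ∀ x, q x ≤ B := by
  refine ⟨_, _, ?_, lintegral_comp_sub_le (gaussianPDF_le 0 N) μ⟩
  rw [Measure.conv_comm]
  exact (hasDensity_gaussianReal 0 hN).conv μ

/-- The mean is not assumed to vanish, so the variance is only bounded by the power. -/
theorem IsLawWithPower.exists_gaussianReal {N : ℝ≥0} {μ : Measure ℝ} (h : IsLawWithPower N μ)
    (hG : IsGaussian μ) : ∃ (m : ℝ) (v : ℝ≥0), v ≤ N ∧ μ = gaussianReal m v := by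
  obtain ⟨_, h2, hN⟩ := h
  refine ⟨_, _, ?_, hG.eq_gaussianReal⟩
  rw [variance_eq_sub h2]
  refine Real.toNNReal_le_iff_le_coe.2 ?_
  have : ∫ x, (id ^ 2 : ℝ → ℝ) x ∂μ = (N : ℝ) := by simpa using hN
  rw [this]
  exact sub_le_self _ (sq_nonneg _)

theorem isLawWithPower_gaussianReal (N : ℝ≥0) : IsLawWithPower N (gaussianReal 0 N) := by
  refine ⟨inferInstance, memLp_id_gaussianReal 2, ?_⟩
  have h := variance_eq_sub (memLp_id_gaussianReal (μ := 0) (v := N) 2)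
  rw [variance_id_gaussianReal] at h
  simpa using h.symm

theorem EReal.coe_add_coe_sub_two_mul_coe (a b c : ℝ) :
    (a : EReal) + b - 2 * c = ((a + b - 2 * c : ℝ) : EReal) := by
  push_cast
  rfl

theorem entropyFunctional_nonpos_of_isGaussian {N : ℝ≥0} (hN : 0 < N) {μ₁ μ₂ : Measure ℝ}
    [IsProbabilityMeasure μ₁] (h₂ : IsLawWithPower N μ₂) (hG : IsGaussian μ₂) :
    entropyFunctional N μ₁ μ₂ ≤ 0 := by
  obtain ⟨m, v, hv, rfl⟩ := h₂.exists_gaussianReal hG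
  obtain ⟨q, B, hq, hqB⟩ := exists_hasDensity_conv_gaussianReal μ₁ hN.ne'
  set γ := gaussianReal 0 N with hγ
  set η := gaussianReal m v with hη
  rw [entropyFunctional]
  -- if `h(X₁) = ⊥` or `h(X₁ + Z₂) = ⊤`, the functional is `⊥`
  by_cases hbot : diffEntropy μ₁ = ⊥
  · simp [hbot, sub_eq_add_neg]
  by_cases htop : diffEntropy (μ₁.conv γ) = ⊤
  · rw [htop, EReal.mul_top_of_pos (by norm_num)]
    simp [sub_eq_add_neg]
  have hac : μ₁ ≪ volume := by
    by_contra hac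
    exact hbot (by rw [diffEntropy, if_neg hac])
  have hp := HasDensity.of_absolutelyContinuous hac
  have hu := hq.conv γ
  have hr := hq.conv η
  have iq := hq.integrable_log_of_ne_top (hq.lintegral_log_ne_top_of_le hqB) htop
  obtain ⟨ip, -⟩ := entropy_le_entropy_conv hp hq (hp.lintegral_log_ne_top_of_ne_bot hbot) iq
  obtain ⟨iu, hle⟩ := entropy_conv_conv_add_le hp hq hu ip iq
    (hu.lintegral_log_ne_top_of_le (lintegral_comp_sub_le hqB γ))
  -- `X₂` becomes a centred Gaussian of variance `N` after adding an independent Gaussian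
  have hconv : ((μ₁.conv γ).conv η).conv (gaussianReal (-m) (N - v)) = (μ₁.conv γ).conv γ := by
    rw [Measure.conv_assoc, hη, gaussianReal_conv_gaussianReal, add_neg_cancel,
      add_tsub_cancel_of_le hv]
  rw [← hconv] at hu iu hle
  obtain ⟨ir, hle'⟩ := entropy_le_entropy_conv hr hu
    (hr.lintegral_log_ne_top_of_le (lintegral_comp_sub_le hqB η)) iu
  rw [hp.diffEntropy_eq_integral ip, hq.diffEntropy_eq_integral iq, hr.diffEntropy_eq_integral ir]
  rw [EReal.coe_add_coe_sub_two_mul_coe, EReal.coe_nonpos]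
  linarith

theorem log_gaussianPDF (m : ℝ) {v : ℝ≥0} (hv : v ≠ 0) (x : ℝ) :
    Real.log (gaussianPDF m v x).toReal
      = -(Real.log (2 * Real.pi * v) / 2) - (x - m) ^ 2 / (2 * v) := by
  have hv' : (0 : ℝ) < v := by positivity
  rw [toReal_gaussianPDF, gaussianPDFReal, Real.log_mul (by positivity) (by positivity),
    Real.log_exp, Real.log_inv, Real.log_sqrt (by positivity)]
  ring

theorem diffEntropy_gaussianReal {v : ℝ≥0} (hv : v ≠ 0) :
    diffEntropy (gaussianReal 0 v) = ((Real.log (2 * Real.pi * v) / 2 + 1 / 2 : ℝ) : EReal) := by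
  have hv' : (v : ℝ) ≠ 0 := by simpa using hv
  have i2 : Integrable (fun x : ℝ => x ^ 2) (gaussianReal 0 v) :=
    (isLawWithPower_gaussianReal v).2.1.integrable_sq
  have hi : Integrable (fun x => Real.log (gaussianPDF 0 v x).toReal) (gaussianReal 0 v) := by
    simp_rw [log_gaussianPDF 0 hv, sub_zero]
    exact (integrable_const _).sub (i2.div_const _)
  rw [(hasDensity_gaussianReal 0 hv).diffEntropy_eq_integral hi]
  congr 1
  simp_rw [log_gaussianPDF 0 hv, sub_zero]
  rw [integral_sub (integrable_const _) (i2.div_const _), integral_div,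
    (isLawWithPower_gaussianReal v).2.2]
  simp
  field_simp
  ring

theorem entropyFunctional_gaussianReal {N s : ℝ≥0} (hN : 0 < N) (hs : 0 < s) :
    entropyFunctional N (gaussianReal 0 s) (gaussianReal 0 N) =
      ((Real.log ((s + N + N : ℝ) * s / (s + N) ^ 2) / 2 : ℝ) : EReal) := by
  have hN' : (0 : ℝ) < N := hN
  have hs' : (0 : ℝ) < s := hs
  rw [entropyFunctional, gaussianReal_conv_gaussianReal, gaussianReal_conv_gaussianReal]
  simp only [add_zero]
  rw [diffEntropy_gaussianReal (by positivity), diffEntropy_gaussianReal (by positivity),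
    diffEntropy_gaussianReal (by positivity)]
  rw [EReal.coe_add_coe_sub_two_mul_coe]
  congr 1
  push_cast
  have hpi := Real.pi_pos
  rw [Real.log_div (by positivity) (by positivity), Real.log_mul (by positivity) hs'.ne',
    Real.log_pow, Real.log_mul (y := (s + N + N : ℝ)) (by positivity) (by positivity),
    Real.log_mul (y := (s : ℝ)) (by positivity) (by positivity),
    Real.log_mul (y := (s + N : ℝ)) (by positivity) (by positivity)]
  push_cast
  ring

theorem tendsto_entropyFunctional_gaussianReal {N : ℝ≥0} (hN : 0 < N) :
    Filter.Tendsto (fun n : ℕ =>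
      entropyFunctional N (gaussianReal 0 (n + 1 : ℝ≥0)) (gaussianReal 0 N)) Filter.atTop
      (nhds 0) := by
  simp_rw [fun n : ℕ => entropyFunctional_gaussianReal hN (s := n + 1) (by positivity)]
  rw [← EReal.coe_zero, EReal.tendsto_coe]
  have hN' : (0 : ℝ) < N := hN
  have h0 : Filter.Tendsto (fun n : ℕ => ((n : ℝ) + 1 + N)) Filter.atTop Filter.atTop := by
    simp_rw [add_assoc]
    exact Filter.tendsto_atTop_add_const_right _ _ tendsto_natCast_atTop_atTop
  have h1 : Filter.Tendsto (fun n : ℕ => 1 - (N / ((n : ℝ) + 1 + N)) ^ 2) Filter.atTop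
      (nhds (1 - 0 ^ 2)) := ((h0.const_div_atTop (N : ℝ)).pow 2).const_sub 1
  have h2 := ((Real.continuousAt_log (by norm_num : (1 - 0 ^ 2 : ℝ) ≠ 0)).tendsto.comp
    h1).div_const 2
  simp only [ne_eq, OfNat.ofNat_ne_zero, not_false_eq_true, zero_pow, sub_zero, Real.log_one,
    zero_div] at h2
  refine h2.congr fun n => ?_
  simp only [Function.comp_apply]
  push_cast
  congr 2
  field_simp
  ring

theorem sSup_entropyFunctional_isGaussian (N : ℝ≥0) (hN : 0 < N) :
    sSup {v : EReal | ∃ μ₁ μ₂ : Measure ℝ, IsProbabilityMeasure μ₁ ∧ IsLawWithPower N μ₂ ∧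
      IsGaussian μ₂ ∧ v = entropyFunctional N μ₁ μ₂} = 0 := by
  refine le_antisymm (sSup_le ?_) (le_of_tendsto'
    (tendsto_entropyFunctional_gaussianReal hN) fun n => le_sSup ?_)
  · rintro _ ⟨μ₁, μ₂, h₁, h₂, hG, rfl⟩
    exact entropyFunctional_nonpos_of_isGaussian hN h₂ hG
  · exact ⟨_, _, inferInstance, isLawWithPower_gaussianReal N, inferInstance, rfl⟩

/-! ### Detecting a rare jump -/

/-- The law of a variable that equals `K` with probability `ε` and `0` otherwise. -/
noncomputable def rareJump (ε K : ℝ) : Measure ℝ :=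
  ENNReal.ofReal (1 - ε) • Measure.dirac 0 + ENNReal.ofReal ε • Measure.dirac K

section RareJump

variable {ε K : ℝ}

theorem isProbabilityMeasure_rareJump (hε : 0 ≤ ε) (hε1 : ε ≤ 1) :
    IsProbabilityMeasure (rareJump ε K) := by
  refine ⟨?_⟩
  simp only [rareJump, Measure.add_apply, Measure.smul_apply, measure_univ, smul_eq_mul, mul_one]
  rw [← ENNReal.ofReal_add (by linarith) hε]
  simp

theorem rareJump_singleton (hK : K ≠ 0) : rareJump ε K {K} = ENNReal.ofReal ε := by
  simp [rareJump, hK.symm]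

theorem rareJump_compl_zero (hK : K ≠ 0) : rareJump ε K {0}ᶜ = ENNReal.ofReal ε := by
  simp [rareJump, hK]

theorem isLawWithPower_rareJump (hε : 0 ≤ ε) (hε1 : ε ≤ 1) {N : ℝ≥0} (hN : ε * K ^ 2 = N) :
    IsLawWithPower N (rareJump ε K) := by
  have hp := isProbabilityMeasure_rareJump (K := K) hε hε1
  have hi : ∀ f : ℝ → ℝ, Integrable f (ENNReal.ofReal (1 - ε) • Measure.dirac 0) ∧
      Integrable f (ENNReal.ofReal ε • Measure.dirac K) := fun f =>
    ⟨(integrable_dirac (by simp)).smul_measure (by simp),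
      (integrable_dirac (by simp)).smul_measure (by simp)⟩
  refine ⟨hp, ?_, ?_⟩
  · rw [memLp_two_iff_integrable_sq measurable_id.aestronglyMeasurable]
    exact (hi _).1.add_measure (hi _).2
  · rw [rareJump, integral_add_measure (hi _).1 (hi _).2, integral_smul_measure,
      integral_smul_measure]
    simp [ENNReal.toReal_ofReal hε, hN]

/-- If `Q` is concentrated on `|x| < K / 2`, observing whether `Q + W` exceeds `K / 2` detects a
rare jump `W`, so that the jump increases the entropy by at least `ε (L / 2 - 1)`, where `exp (-L)`
bounds the probability of a detection. -/
theorem le_entropy_conv_rareJump_sub {ρ : Measure ℝ} [IsProbabilityMeasure ρ] {q r : ℝ → ℝ≥0∞}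
    (hε : 0 ≤ ε) (hε1 : ε ≤ 1) (hK : 0 < K) {L δ : ℝ} (hL : 0 ≤ L) (hδ0 : 0 ≤ δ) (hδ : δ ≤ 1 / 2)
    (htail : ρ {x | K / 2 ≤ |x|} ≤ ENNReal.ofReal δ) (hLδ : Real.exp L * (δ + ε) ≤ 1)
    (hq : HasDensity ρ q) (hr : HasDensity (ρ.conv (rareJump ε K)) r)
    (hlq : Integrable (fun x => Real.log (q x).toReal) ρ)
    (hlr : Integrable (fun x => Real.log (r x).toReal) (ρ.conv (rareJump ε K))) :
    ε * (L / 2 - 1) ≤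
      -∫ x, Real.log (r x).toReal ∂(ρ.conv (rareJump ε K)) - -∫ x, Real.log (q x).toReal ∂ρ := by
  have hη := isProbabilityMeasure_rareJump (K := K) hε hε1
  set η := rareJump ε K with hηdef
  have hη1 : η {K} = ENNReal.ofReal ε := rareJump_singleton hK.ne'
  have hη0 : η {0}ᶜ = ENNReal.ofReal ε := rareJump_compl_zero hK.ne'
  set S : Set (ℝ × ℝ) := {K} ×ˢ Set.Ici (K / 2) with hS
  have mS : MeasurableSet S := (measurableSet_singleton K).prod measurableSet_Ici
  have mφ : Measurable (S.indicator fun _ => L) := measurable_const.indicator mS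
  -- the test function, read on the pair `(Q, W)`
  have hφ : (fun y : ℝ × ℝ => S.indicator (fun _ => L) (y.2, y.1 + y.2))
      = (Set.Ici (-(K / 2)) ×ˢ {K}).indicator fun _ => L := by
    funext y
    have : (y.2, y.1 + y.2) ∈ S ↔ y ∈ Set.Ici (-(K / 2)) ×ˢ ({K} : Set ℝ) := by
      simp only [hS, Set.mem_prod, Set.mem_singleton_iff, Set.mem_Ici]
      constructor
      · rintro ⟨h1, h2⟩; exact ⟨by linarith, h1⟩
      · rintro ⟨h1, h2⟩; exact ⟨h2, by linarith⟩
    by_cases h : (y.2, y.1 + y.2) ∈ S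
    · rw [Set.indicator_of_mem h, Set.indicator_of_mem (this.1 h)]
    · rw [Set.indicator_of_notMem h, Set.indicator_of_notMem (this.not.1 h)]
  have mT : MeasurableSet (Set.Ici (-(K / 2)) ×ˢ ({K} : Set ℝ)) :=
    measurableSet_Ici.prod (measurableSet_singleton K)
  have hdetect : (ρ.conv η) (Set.Ici (K / 2)) ≤ ENNReal.ofReal (δ + ε) := by
    rw [← measurePreserving_add_prod.measure_preimage measurableSet_Ici.nullMeasurableSet,
      ENNReal.ofReal_add hδ0 hε, ← hη0]
    refine le_trans (measure_mono (t := ({x | K / 2 ≤ |x|} ×ˢ Set.univ) ∪ (Set.univ ×ˢ {0}ᶜ)) ?_)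
      ((measure_union_le _ _).trans (add_le_add ?_ ?_))
    · intro y hy
      simp only [Set.mem_preimage, Set.mem_Ici] at hy
      by_cases h : y.2 = 0
      · left
        rw [h, add_zero] at hy
        exact ⟨hy.trans (le_abs_self _), trivial⟩
      · right
        exact ⟨trivial, h⟩
    · rw [Measure.prod_prod, measure_univ, mul_one]
      exact htail
    · rw [Measure.prod_prod, measure_univ, one_mul]
  have key := integral_le_entropy_conv_sub hq hr hlq hlr
    (φ := fun w t => S.indicator (fun _ => L) (w, t)) mφ
    (by
      simp only [hφ]
      exact (integrable_const L).indicator mT) (c := 1 + ε) (by linarith)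
    (by
      rw [lintegral_lintegral (f := fun w t => ENNReal.ofReal
        (Real.exp (S.indicator (fun _ => L) (w, t)))) (by
          exact (Real.measurable_exp.comp mφ).ennreal_ofReal.aemeasurable)]
      have hle : ∀ y : ℝ × ℝ, ENNReal.ofReal (Real.exp (S.indicator (fun _ => L) (y.1, y.2)))
          ≤ 1 + S.indicator (fun _ => ENNReal.ofReal (Real.exp L)) y := fun y => by
        by_cases h : y ∈ S
        · simp [h]
        · simp [h]
      refine (lintegral_mono hle).trans ?_
      rw [lintegral_add_left measurable_const, lintegral_indicator_const mS, hS,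
        Measure.prod_prod, hη1, ENNReal.ofReal_add zero_le_one hε]
      simp only [lintegral_const, measure_univ, mul_one, ENNReal.ofReal_one]
      gcongr
      calc ENNReal.ofReal (Real.exp L) * (ENNReal.ofReal ε * (ρ.conv η) (Set.Ici (K / 2)))
          ≤ ENNReal.ofReal (Real.exp L) * (ENNReal.ofReal ε * ENNReal.ofReal (δ + ε)) := by
            gcongr
        _ = ENNReal.ofReal (ε * (Real.exp L * (δ + ε))) := by
            rw [← ENNReal.ofReal_mul hε, ← ENNReal.ofReal_mul (Real.exp_pos _).le]
            congr 1; ring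
        _ ≤ ENNReal.ofReal ε :=
            ENNReal.ofReal_le_ofReal (mul_le_of_le_one_right hε hLδ))
  simp only [hφ] at key
  rw [integral_indicator_const _ mT, measureReal_prod_prod, smul_eq_mul, measureReal_def η, hη1,
    ENNReal.toReal_ofReal hε] at key
  have hhalf : 1 / 2 ≤ ρ.real (Set.Ici (-(K / 2))) := by
    have h1 : ρ.real (Set.Ici (-(K / 2)))ᶜ ≤ δ := by
      refine ENNReal.toReal_le_of_le_ofReal hδ0 (le_trans (measure_mono ?_) htail)
      intro x hx
      simp only [Set.mem_compl_iff, Set.mem_Ici, not_le] at hx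
      change K / 2 ≤ |x|
      exact le_abs.2 (Or.inr (by linarith))
    rw [probReal_compl_eq_one_sub measurableSet_Ici] at h1
    linarith
  have : 1 / 2 * ε * L ≤ ρ.real (Set.Ici (-(K / 2))) * ε * L := by gcongr
  linarith

end RareJump

/-! ### The density proportional to `exp (-x⁴)` -/

theorem integrable_exp_neg_half_pow_four : Integrable fun x : ℝ => Real.exp (-(x ^ 4 / 2)) := by
  have h : Integrable fun x : ℝ => Real.exp (1 / 2) * Real.exp (-1 * x ^ 2) :=
    (integrable_exp_neg_mul_sq one_pos).const_mul _
  refine h.mono' (by fun_prop) (Filter.Eventually.of_forall fun x => ?_)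
  rw [Real.norm_of_nonneg (Real.exp_pos _).le, ← Real.exp_add]
  exact Real.exp_le_exp.2 (by nlinarith [sq_nonneg (x ^ 2 - 1)])

theorem integrable_exp_neg_pow_four : Integrable fun x : ℝ => Real.exp (-x ^ 4) := by
  refine integrable_exp_neg_half_pow_four.mono' (by fun_prop)
    (Filter.Eventually.of_forall fun x => ?_)
  rw [Real.norm_of_nonneg (Real.exp_pos _).le]
  exact Real.exp_le_exp.2 (by nlinarith [sq_nonneg (x ^ 2)])

/-- The normalizing constant `∫ exp (-x⁴)`. -/
noncomputable def quarticConst : ℝ := ∫ x : ℝ, Real.exp (-x ^ 4)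

theorem quarticConst_pos : 0 < quarticConst :=
  integral_exp_pos integrable_exp_neg_pow_four

/-- The probability density proportional to `exp (-(x / σ)⁴)`. -/
noncomputable def quarticPDF (σ x : ℝ) : ℝ≥0∞ :=
  ENNReal.ofReal (Real.exp (-(x / σ) ^ 4) / (quarticConst * σ))

/-- The law on `ℝ` with density proportional to `exp (-x⁴)`. -/
noncomputable def quarticLaw : Measure ℝ := volume.withDensity (quarticPDF 1)

theorem measurable_quarticPDF (σ : ℝ) : Measurable (quarticPDF σ) := by
  unfold quarticPDF; fun_prop

theorem toReal_quarticPDF {σ : ℝ} (hσ : 0 < σ) (x : ℝ) :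
    (quarticPDF σ x).toReal = Real.exp (-(x / σ) ^ 4) / (quarticConst * σ) := by
  have := quarticConst_pos
  exact ENNReal.toReal_ofReal (by positivity)

theorem log_quarticPDF {σ : ℝ} (hσ : 0 < σ) (x : ℝ) :
    Real.log (quarticPDF σ x).toReal = -Real.log (quarticConst * σ) - (x / σ) ^ 4 := by
  have := quarticConst_pos
  rw [toReal_quarticPDF hσ, Real.log_div (by positivity) (by positivity), Real.log_exp]
  ring

theorem hasDensity_quarticLaw : HasDensity quarticLaw (quarticPDF 1) :=
  ⟨measurable_quarticPDF 1, rfl⟩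

instance : IsProbabilityMeasure quarticLaw := by
  refine ⟨?_⟩
  have h := hasDensity_quarticLaw.lintegral_eq (g := fun _ => 1) measurable_const
  simp only [lintegral_const, one_mul, mul_one] at h
  rw [h]
  have hC := quarticConst_pos
  simp only [quarticPDF, div_one, mul_one]
  rw [← ofReal_integral_eq_lintegral_ofReal (integrable_exp_neg_pow_four.div_const _)
    (Filter.Eventually.of_forall fun x => by positivity), integral_div]
  change ENNReal.ofReal (quarticConst / quarticConst) = 1
  rw [div_self hC.ne', ENNReal.ofReal_one]

theorem hasDensity_map_quarticLaw {σ : ℝ} (hσ : 0 < σ) :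
    HasDensity (quarticLaw.map (σ * ·)) (quarticPDF σ) := by
  refine ⟨measurable_quarticPDF σ, Measure.ext_of_lintegral _ fun g hg => ?_⟩
  have mσ : Measurable fun x : ℝ => σ * x := by fun_prop
  have mp := measurable_quarticPDF σ
  have hC := quarticConst_pos
  rw [lintegral_map hg mσ,
    hasDensity_quarticLaw.lintegral_eq (g := fun x => g (σ * x)) (hg.comp mσ),
    lintegral_withDensity_eq_lintegral_mul _ mp hg]
  have hvol : (volume : Measure ℝ) = ENNReal.ofReal σ • Measure.map (σ * ·) volume := by
    rw [Real.map_volume_mul_left hσ.ne', smul_smul, abs_of_pos (inv_pos.2 hσ),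
      ← ENNReal.ofReal_mul hσ.le, mul_inv_cancel₀ hσ.ne', ENNReal.ofReal_one, one_smul]
  conv_rhs => rw [hvol]
  rw [lintegral_smul_measure, lintegral_map (mp.mul hg) mσ, smul_eq_mul,
    ← lintegral_const_mul' _ _ ENNReal.ofReal_ne_top]
  refine lintegral_congr fun x => ?_
  simp only [Pi.mul_apply]
  rw [← mul_assoc]
  congr 1
  rw [quarticPDF, quarticPDF, ← ENNReal.ofReal_mul hσ.le]
  congr 1
  rw [mul_div_cancel_left₀ _ hσ.ne']
  field_simp

/-- Exponential integrability gives both the moments and the tails of the quartic law. -/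
theorem integrable_quarticLaw_exp_half :
    Integrable (fun x : ℝ => Real.exp (x ^ 4 / 2)) quarticLaw := by
  have hC := quarticConst_pos
  rw [quarticLaw, integrable_withDensity_iff_integrable_smul' (measurable_quarticPDF 1)
    (Filter.Eventually.of_forall fun x => ENNReal.ofReal_lt_top)]
  refine (integrable_exp_neg_half_pow_four.div_const quarticConst).congr
    (Filter.Eventually.of_forall fun x => ?_)
  simp only [toReal_quarticPDF one_pos, smul_eq_mul, div_one, mul_one]
  rw [div_mul_eq_mul_div, ← Real.exp_add]
  congr 2
  ring

theorem integrable_quarticLaw_pow {k : ℕ} (hk : k ≤ 4) :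
    Integrable (fun x : ℝ => x ^ k) quarticLaw := by
  refine (integrable_quarticLaw_exp_half.const_mul 2).mono' (by fun_prop)
    (Filter.Eventually.of_forall fun x => ?_)
  have h1 : x ^ 4 / 2 + 1 ≤ Real.exp (x ^ 4 / 2) := Real.add_one_le_exp _
  have h4 : |x| ^ 4 = x ^ 4 := by rw [← abs_pow, abs_of_nonneg (by positivity)]
  have h2 : |x| ^ k ≤ 1 + |x| ^ 4 := by
    rcases le_total |x| 1 with h | h
    · have := pow_le_one₀ (n := k) (abs_nonneg x) h
      have := pow_nonneg (abs_nonneg x) 4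
      linarith
    · have := pow_le_pow_right₀ h hk
      linarith
  rw [Real.norm_eq_abs, abs_pow]
  linarith

theorem quarticLaw_tail {s : ℝ} (hs : 0 ≤ s) :
    quarticLaw {x | s ≤ |x|} ≤
      ENNReal.ofReal (Real.exp (-(s ^ 4 / 2)) * ∫ x, Real.exp (x ^ 4 / 2) ∂quarticLaw) := by
  have h := mul_meas_ge_le_integral_of_nonneg (μ := quarticLaw)
    (f := fun x => Real.exp (x ^ 4 / 2)) (Filter.Eventually.of_forall fun x => (Real.exp_pos _).le)
    integrable_quarticLaw_exp_half (Real.exp (s ^ 4 / 2))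
  have hsub : {x : ℝ | s ≤ |x|} ⊆ {x | Real.exp (s ^ 4 / 2) ≤ Real.exp (x ^ 4 / 2)} := by
    intro x hx
    have h4 : |x| ^ 4 = x ^ 4 := by rw [← abs_pow, abs_of_nonneg (by positivity)]
    have := pow_le_pow_left₀ hs (show s ≤ |x| from hx) 4
    exact Real.exp_le_exp.2 (by linarith)
  refine (measure_mono hsub).trans ?_
  rw [← ofReal_measureReal]
  refine ENNReal.ofReal_le_ofReal ?_
  rw [Real.exp_neg, inv_mul_eq_div, le_div_iff₀ (Real.exp_pos _), mul_comm]
  exact h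

/-! ### Gaussian smoothing of the quartic law -/

section ConvGaussian

variable {σ : ℝ} {N : ℝ≥0}

theorem isProbabilityMeasure_map_quarticLaw (σ : ℝ) :
    IsProbabilityMeasure (quarticLaw.map (σ * ·)) :=
  Measure.isProbabilityMeasure_map (by fun_prop)

theorem entropy_map_quarticLaw (hσ : 0 < σ) :
    Integrable (fun x => Real.log (quarticPDF σ x).toReal) (quarticLaw.map (σ * ·)) ∧
      -∫ x, Real.log (quarticPDF σ x).toReal ∂(quarticLaw.map (σ * ·)) =
        Real.log (quarticConst * σ) + ∫ y, y ^ 4 ∂quarticLaw := by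
  have i4 := integrable_quarticLaw_pow le_rfl
  simp_rw [log_quarticPDF hσ]
  have e : (fun y : ℝ => -Real.log (quarticConst * σ) - (σ * y / σ) ^ 4)
      = fun y => -Real.log (quarticConst * σ) - y ^ 4 := by
    funext y; rw [mul_div_cancel_left₀ _ hσ.ne']
  constructor
  · rw [integrable_map_measure (by fun_prop) (by fun_prop)]
    change Integrable (fun y : ℝ => -Real.log (quarticConst * σ) - (σ * y / σ) ^ 4) quarticLaw
    rw [e]
    exact (integrable_const _).sub i4
  · rw [integral_map (by fun_prop) (by fun_prop), e, integral_sub (integrable_const _) i4]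
    simp [add_comm]

theorem integrable_gaussianReal_pow (N : ℝ≥0) (k : ℕ) :
    Integrable (fun z : ℝ => z ^ k) (gaussianReal 0 N) := by
  have h := memLp_id_gaussianReal' (μ := 0) (v := N) (k : ℝ≥0∞) (by simp)
  refine (h.integrable_norm_pow' ).mono (by fun_prop) (Filter.Eventually.of_forall fun z => ?_)
  simp

/-- The cross entropy of `X + Z` relative to the law of `X`, whose density is proportional to
`exp (-(x / σ)⁴)`, is `log σ` plus a polynomial in `σ⁻¹`. The term in `σ⁻¹` vanishes because `Z` is
centred. -/
theorem cross_entropy_map_quarticLaw_conv (hσ : 0 < σ) :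
    Integrable (fun x => Real.log (quarticPDF σ x).toReal)
        ((quarticLaw.map (σ * ·)).conv (gaussianReal 0 N)) ∧
      -∫ x, Real.log (quarticPDF σ x).toReal
          ∂((quarticLaw.map (σ * ·)).conv (gaussianReal 0 N)) =
        Real.log (quarticConst * σ) + (∫ y, y ^ 4 ∂quarticLaw
          + 6 * (∫ y, y ^ 2 ∂quarticLaw) * N / σ ^ 2
          + 4 * (∫ y, y ^ 1 ∂quarticLaw) * (∫ z, z ^ 3 ∂gaussianReal 0 N) / σ ^ 3
          + (∫ z, z ^ 4 ∂gaussianReal 0 N) / σ ^ 4) := by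
  have := isProbabilityMeasure_map_quarticLaw σ
  set γ := gaussianReal 0 N with hγ
  have mp : MeasurePreserving (fun y : ℝ × ℝ => σ * y.1 + y.2) (quarticLaw.prod γ)
      ((quarticLaw.map (σ * ·)).conv γ) := by
    have h : MeasurePreserving (σ * ·) quarticLaw (quarticLaw.map (σ * ·)) := ⟨by fun_prop, rfl⟩
    exact measurePreserving_add_prod.comp (h.prod (MeasurePreserving.id γ))
  have ii : ∀ j k : ℕ, j ≤ 4 → ∀ c : ℝ,
      Integrable (fun y : ℝ × ℝ => c * (y.1 ^ j * y.2 ^ k)) (quarticLaw.prod γ) :=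
    fun j k hj c => ((integrable_quarticLaw_pow hj).mul_prod
      (integrable_gaussianReal_pow N k)).const_mul c
  have iv : ∀ (j k : ℕ) (c : ℝ), ∫ y : ℝ × ℝ, c * (y.1 ^ j * y.2 ^ k) ∂(quarticLaw.prod γ)
      = c * ((∫ y, y ^ j ∂quarticLaw) * ∫ z, z ^ k ∂γ) := fun j k c => by
    rw [integral_const_mul, integral_prod_mul (fun y : ℝ => y ^ j) (fun z : ℝ => z ^ k)]
  have e : (fun y : ℝ × ℝ => ((σ * y.1 + y.2) / σ) ^ 4) = fun y : ℝ × ℝ =>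
      1 * (y.1 ^ 4 * y.2 ^ 0) + 4 / σ * (y.1 ^ 3 * y.2 ^ 1) + 6 / σ ^ 2 * (y.1 ^ 2 * y.2 ^ 2)
        + 4 / σ ^ 3 * (y.1 ^ 1 * y.2 ^ 3) + 1 / σ ^ 4 * (y.1 ^ 0 * y.2 ^ 4) := by
    funext y; field_simp; ring
  have j1 := ii 4 0 le_rfl 1
  have j2 := j1.add (ii 3 1 (by norm_num) (4 / σ))
  have j3 := j2.add (ii 2 2 (by norm_num) (6 / σ ^ 2))
  have j4 := j3.add (ii 1 3 (by norm_num) (4 / σ ^ 3))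
  have j5 := j4.add (ii 0 4 (by norm_num) (1 / σ ^ 4))
  have i5 : Integrable (fun y : ℝ × ℝ => ((σ * y.1 + y.2) / σ) ^ 4) (quarticLaw.prod γ) := by
    rw [e]; exact j5
  have v5 : ∫ y : ℝ × ℝ, ((σ * y.1 + y.2) / σ) ^ 4 ∂(quarticLaw.prod γ) =
      ∫ y, y ^ 4 ∂quarticLaw
          + 6 * (∫ y, y ^ 2 ∂quarticLaw) * N / σ ^ 2
          + 4 * (∫ y, y ^ 1 ∂quarticLaw) * (∫ z, z ^ 3 ∂γ) / σ ^ 3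
          + (∫ z, z ^ 4 ∂γ) / σ ^ 4 := by
    rw [e]
    erw [integral_add j4 (ii 0 4 (by norm_num) _), integral_add j3 (ii 1 3 (by norm_num) _),
      integral_add j2 (ii 2 2 (by norm_num) _), integral_add j1 (ii 3 1 (by norm_num) _)]
    rw [iv, iv, iv, iv, iv, (isLawWithPower_gaussianReal N).2.2]
    have h1 : ∫ z, z ^ 1 ∂γ = 0 := by
      simp_rw [pow_one]; exact integral_id_gaussianReal
    rw [h1]
    simp
    ring
  have mm : Measurable fun x => Real.log (quarticPDF σ x).toReal :=
    (hasDensity_map_quarticLaw hσ).measurable_log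
  constructor
  · rw [← mp.integrable_comp mm.aestronglyMeasurable]
    change Integrable (fun y : ℝ × ℝ => Real.log (quarticPDF σ (σ * y.1 + y.2)).toReal) _
    simp_rw [log_quarticPDF hσ]
    exact (integrable_const _).sub i5
  · rw [← mp.integral_comp_of_measurable mm]
    simp_rw [log_quarticPDF hσ]
    rw [integral_sub (integrable_const _) i5, v5]
    simp [add_comm]

theorem gaussianReal_tail {K : ℝ} (hK : 0 < K) :
    gaussianReal 0 N {z | K / 4 ≤ |z|} ≤ ENNReal.ofReal (16 * (N / K ^ 2)) := by
  have h := meas_ge_le_variance_div_sq (memLp_id_gaussianReal (μ := 0) (v := N) 2)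
    (show 0 < K / 4 by positivity)
  rw [variance_id_gaussianReal] at h
  simp only [id, integral_id_gaussianReal, sub_zero] at h
  refine h.trans (ENNReal.ofReal_le_ofReal (le_of_eq ?_))
  field_simp
  norm_num

theorem map_quarticLaw_conv_tail (hσ : 0 < σ) {κ : ℝ} (hκ : 0 < κ) :
    (quarticLaw.map (σ * ·)).conv (gaussianReal 0 N) {x | κ * σ / 2 ≤ |x|} ≤
      ENNReal.ofReal (Real.exp (-(κ ^ 4 / 512)) * (∫ x, Real.exp (x ^ 4 / 2) ∂quarticLaw)
        + 16 * (N / (κ * σ) ^ 2)) := by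
  have := isProbabilityMeasure_map_quarticLaw σ
  have mset : ∀ c : ℝ, MeasurableSet {x : ℝ | c ≤ |x|} := fun c =>
    measurableSet_le measurable_const (by fun_prop)
  rw [← measurePreserving_add_prod.measure_preimage (mset _).nullMeasurableSet,
    ENNReal.ofReal_add (mul_nonneg (Real.exp_pos _).le
      (integral_nonneg fun x => (Real.exp_pos _).le)) (by positivity)]
  refine le_trans (measure_mono (t := ({x | κ * σ / 4 ≤ |x|} ×ˢ Set.univ) ∪
    (Set.univ ×ˢ {z | κ * σ / 4 ≤ |z|})) ?_) ((measure_union_le _ _).trans (add_le_add ?_ ?_))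
  · intro y hy
    have hy' : κ * σ / 2 ≤ |y.1 + y.2| := hy
    have := abs_add_le y.1 y.2
    rcases le_total (κ * σ / 4) |y.1| with h | h
    · exact Or.inl ⟨h, trivial⟩
    · exact Or.inr ⟨trivial, show κ * σ / 4 ≤ |y.2| by linarith⟩
  · rw [Measure.prod_prod, measure_univ, mul_one, Measure.map_apply (by fun_prop) (mset _)]
    have hpre : (fun x => σ * x) ⁻¹' {x | κ * σ / 4 ≤ |x|} = {x | κ / 4 ≤ |x|} := by
      ext x
      simp only [Set.mem_preimage, Set.mem_ofPred_eq, abs_mul, abs_of_pos hσ]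
      rw [show κ * σ / 4 = σ * (κ / 4) by ring, mul_le_mul_iff_right₀ hσ]
    rw [hpre]
    refine (quarticLaw_tail (by positivity)).trans (le_of_eq ?_)
    congr 4
    ring
  · rw [Measure.prod_prod, measure_univ, one_mul]
    exact gaussianReal_tail (by positivity)

end ConvGaussian

/-! ### Positivity of the functional -/

/-- With `X₁` a dilation by `σ` of the quartic law and `X₂` a jump of size `√s σ`, the entropy
functional is positive as soon as the displayed inequalities hold. -/
theorem entropyFunctional_map_quarticLaw_rareJump_pos {N : ℝ≥0} (hN : 0 < N) {s σ ε L δ D : ℝ}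
    (hs : 0 < s) (hσ : 0 < σ) (hε : ε = N / (√s * σ) ^ 2) (hε1 : ε ≤ 1) (hL : 0 ≤ L)
    (hδ : δ = Real.exp (-(√s ^ 4 / 512)) * (∫ x, Real.exp (x ^ 4 / 2) ∂quarticLaw) + 16 * ε)
    (hδ2 : δ ≤ 1 / 2) (hLδ : Real.exp L * (δ + ε) ≤ 1)
    (hD : D = 6 * (∫ y, y ^ 2 ∂quarticLaw) * N / σ ^ 2
          + 4 * (∫ y, y ^ 1 ∂quarticLaw) * (∫ z, z ^ 3 ∂gaussianReal 0 N) / σ ^ 3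
          + (∫ z, z ^ 4 ∂gaussianReal 0 N) / σ ^ 4)
    (hlt : D < ε * (L / 2 - 1)) :
    0 < entropyFunctional N (quarticLaw.map (σ * ·)) (rareJump ε (√s * σ)) := by
  have hprob := isProbabilityMeasure_map_quarticLaw σ
  have hK : 0 < √s * σ := by positivity
  have hε0 : 0 ≤ ε := by rw [hε]; positivity
  have hη := isProbabilityMeasure_rareJump (K := √s * σ) hε0 hε1
  have hδ0 : 0 ≤ δ := by
    rw [hδ]
    exact add_nonneg (mul_nonneg (Real.exp_pos _).le
      (integral_nonneg fun x => (Real.exp_pos _).le)) (by positivity)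
  have hp := hasDensity_map_quarticLaw hσ
  obtain ⟨q, B, hq, hqB⟩ := exists_hasDensity_conv_gaussianReal (quarticLaw.map (σ * ·)) hN.ne'
  have hr := hq.conv (rareJump ε (√s * σ))
  have hrl := hr.lintegral_log_ne_top_of_le (lintegral_comp_sub_le hqB (rareJump ε (√s * σ)))
  obtain ⟨ip, ep⟩ := entropy_map_quarticLaw hσ
  obtain ⟨ic, ec⟩ := cross_entropy_map_quarticLaw_conv (N := N) hσ
  have hpos : ∀ x, 0 < (quarticPDF σ x).toReal := fun x => by
    have := quarticConst_pos
    rw [toReal_quarticPDF hσ]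
    positivity
  obtain ⟨iq, hqc⟩ := entropy_le_cross_entropy hp hq (hq.lintegral_log_ne_top_of_le hqB) hpos ic
  rw [entropyFunctional, hp.diffEntropy_eq_integral ip, hq.diffEntropy_eq_integral iq]
  by_cases htop : diffEntropy (((quarticLaw.map (σ * ·)).conv (gaussianReal 0 N)).conv
      (rareJump ε (√s * σ))) = ⊤
  · rw [htop, EReal.top_add_coe]
    have : (2 : EReal) * ((-∫ x, Real.log (q x).toReal
        ∂((quarticLaw.map (σ * ·)).conv (gaussianReal 0 N)) : ℝ) : EReal)
        = ((2 * -∫ x, Real.log (q x).toReal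
        ∂((quarticLaw.map (σ * ·)).conv (gaussianReal 0 N)) : ℝ) : EReal) := by
      push_cast; rfl
    rw [this, EReal.top_sub_coe]
    exact EReal.zero_lt_top
  have ir := hr.integrable_log_of_ne_top hrl htop
  rw [hr.diffEntropy_eq_integral ir, EReal.coe_add_coe_sub_two_mul_coe, EReal.coe_pos]
  have htail := map_quarticLaw_conv_tail (N := N) hσ (Real.sqrt_pos.2 hs)
  rw [← hε, ← hδ] at htail
  have hinc := le_entropy_conv_rareJump_sub hε0 hε1 hK hL hδ0 hδ2 htail hLδ hq hr iq ir
  linarith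

theorem exists_entropyFunctional_pos {N : ℝ≥0} (hN : 0 < N) :
    ∃ μ₁ μ₂ : Measure ℝ, IsProbabilityMeasure μ₁ ∧ IsLawWithPower N μ₂ ∧
      0 < entropyFunctional N μ₁ μ₂ := by
  have hN' : (0 : ℝ) < N := hN
  set M := ∫ y, y ^ 2 ∂quarticLaw with hM
  set E := ∫ x, Real.exp (x ^ 4 / 2) ∂quarticLaw with hE
  set c₃ := 4 * (∫ y, y ^ 1 ∂quarticLaw) * (∫ z, z ^ 3 ∂gaussianReal 0 N) with hc₃
  set c₄ := ∫ z, z ^ 4 ∂gaussianReal 0 N with hc₄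
  have hM0 : 0 ≤ M := integral_nonneg fun y => sq_nonneg y
  have hE0 : 0 < E := integral_exp_pos integrable_quarticLaw_exp_half
  -- `s ^ 2 / 512` has to beat `L = 2 (s (6 M + 1) + 2)`, which is linear in `s`
  set s := 512 * (2 * (6 * M + 1) + 4 + |Real.log (2 * E)|) with hs
  set L := 2 * (s * (6 * M + 1) + 2) with hL
  have hs1 : 1 ≤ s := by rw [hs]; linarith [abs_nonneg (Real.log (2 * E))]
  have hs0 : 0 < s := by linarith
  have hL4 : 4 ≤ L := by rw [hL]; nlinarith
  have hsq : √s ^ 4 = s ^ 2 := by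
    rw [show √s ^ 4 = (√s ^ 2) ^ 2 by ring, Real.sq_sqrt hs0.le]
  have htail : Real.exp L * (Real.exp (-(√s ^ 4 / 512)) * E) ≤ 1 / 2 := by
    have h1 : L - s ^ 2 / 512 ≤ -Real.log (2 * E) := by
      have h2 : s ^ 2 / 512 = s * (2 * (6 * M + 1)) + s * (4 + |Real.log (2 * E)|) := by
        rw [sq, mul_div_assoc]
        conv_lhs => rw [show s / 512 = 2 * (6 * M + 1) + 4 + |Real.log (2 * E)| by
          rw [hs]; ring]
        ring
      have h3 : 4 + |Real.log (2 * E)| ≤ s * (4 + |Real.log (2 * E)|) :=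
        le_mul_of_one_le_left (by positivity) hs1
      rw [h2, hL]
      linarith [le_abs_self (Real.log (2 * E))]
    rw [hsq, ← mul_assoc, ← Real.exp_add, ← sub_eq_add_neg]
    calc Real.exp (L - s ^ 2 / 512) * E ≤ Real.exp (-Real.log (2 * E)) * E := by gcongr
      _ = 1 / 2 := by
        rw [Real.exp_neg, Real.exp_log (by positivity)]
        field_simp
  -- the remaining requirements hold once the dilation `σ` is large
  have hlim : ∀ (c : ℝ) (k : ℕ), k ≠ 0 →
      Filter.Tendsto (fun σ : ℝ => c / σ ^ k) Filter.atTop (nhds 0) := fun c k hk =>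
    (Filter.tendsto_pow_atTop hk).const_div_atTop c
  have hev1 := (hlim (N / s) 2 two_ne_zero).eventually (ge_mem_nhds one_pos)
  have hev2 := (hlim (17 * Real.exp L * (N / s)) 2 two_ne_zero).eventually
    (ge_mem_nhds (show (0 : ℝ) < 1 / 2 by norm_num))
  have hev3 := ((hlim c₃ 1 one_ne_zero).add (hlim c₄ 2 two_ne_zero)).eventually
    (ge_mem_nhds (show (0 + 0 : ℝ) < N by simpa using hN'))
  obtain ⟨σ, hσ, h1, h2, h3⟩ :=
    ((Filter.eventually_gt_atTop 0).and (hev1.and (hev2.and hev3))).exists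
  have hKσ : (√s * σ) ^ 2 = s * σ ^ 2 := by rw [mul_pow, Real.sq_sqrt hs0.le]
  set ε : ℝ := N / (√s * σ) ^ 2 with hε
  have hε' : ε = N / s / σ ^ 2 := by rw [hε, hKσ, div_div]
  have hε0 : 0 < ε := by positivity
  have hε1 : ε ≤ 1 := by rw [hε']; exact h1
  have h2' : Real.exp L * (17 * ε) ≤ 1 / 2 := by
    rw [hε']
    refine le_trans (le_of_eq ?_) h2
    ring
  have hLδ : Real.exp L * (Real.exp (-(√s ^ 4 / 512)) * E + 16 * ε + ε) ≤ 1 := by linarith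
  have hδ2 : Real.exp (-(√s ^ 4 / 512)) * E + 16 * ε ≤ 1 / 2 := by
    have h5 : 2 ≤ Real.exp L := by linarith [Real.add_one_le_exp L]
    have h6 : 0 ≤ Real.exp (-(√s ^ 4 / 512)) * E := by positivity
    nlinarith
  refine ⟨_, _, isProbabilityMeasure_map_quarticLaw σ,
    isLawWithPower_rareJump (K := √s * σ) hε0.le hε1 (by rw [hε]; field_simp),
    entropyFunctional_map_quarticLaw_rareJump_pos hN hs0 hσ hε hε1 (by linarith) rfl hδ2 hLδ rfl ?_⟩
  rw [← hc₃, ← hc₄, ← hM]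
  have e1 : ε * (L / 2 - 1) = 6 * M * N / σ ^ 2 + N / σ ^ 2 + ε := by
    rw [hL, hε']
    field_simp
    ring
  have e2 : c₃ / σ ^ 3 + c₄ / σ ^ 4 = (c₃ / σ ^ 1 + c₄ / σ ^ 2) / σ ^ 2 := by
    field_simp
  have e3 : (c₃ / σ ^ 1 + c₄ / σ ^ 2) / σ ^ 2 ≤ N / σ ^ 2 := by gcongr
  linarith

theorem lemma2 (N₂ : ℝ≥0) (hN₂ : 0 < N₂) :
    0 < sSup {v : EReal | ∃ μ₁ μ₂ : Measure ℝ, IsProbabilityMeasure μ₁ ∧ IsLawWithPower N₂ μ₂ ∧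
        v = entropyFunctional N₂ μ₁ μ₂} ∧
    sSup {v : EReal | ∃ μ₁ μ₂ : Measure ℝ, IsProbabilityMeasure μ₁ ∧ IsLawWithPower N₂ μ₂ ∧
        IsGaussian μ₂ ∧ v = entropyFunctional N₂ μ₁ μ₂} = 0 := by
  obtain ⟨μ₁, μ₂, h₁, h₂, hpos⟩ := exists_entropyFunctional_pos hN₂
  exact ⟨hpos.trans_le (le_sSup ⟨μ₁, μ₂, h₁, h₂, rfl⟩), sSup_entropyFunctional_isGaussian N₂ hN₂⟩
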